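/- Let $n,m$ be integers with $1<m<n/2$ and let $p,q\in(0,1)$. For $x\in\{0,1\}^n$ let $\|x\|_1$ be its number of ones, and let $\mathrm{Jump}_m(x)=m+\|x\|_1$ if $\|x\|_1\in[0..n-m]\cup\{n\}$ and $\mathrm{Jump}_m(x)=n-\|x\|_1$ otherwise. The Markov move-acceptance hyper-heuristic (MMAHH) with the operators OI (only improving) and AM (all moves), maximizing $f=\mathrm{Jump}_m$, starts with $x_0$ uniformly random in $\{0,1\}^n$ and $s_0=\mathrm{OI}$. In iteration $t$ it flips one uniformly random bit of $x_t$ to get $x'$; it sets $x_{t+1}=x'$ if $s_t=\mathrm{AM}$, or if $s_t=\mathrm{OI}$ and $f(x')>f(x_t)$, and $x_{t+1}=x_t$ otherwise. Independently of this, if $s_t=\mathrm{OI}$ then $s_{t+1}=\mathrm{AM}$ with probability $p$ and $s_{t+1}=\mathrm{OI}$ otherwise, and if $s_t=\mathrm{AM}$ then $s_{t+1}=\mathrm{OI}$ with probability $q$ and $s_{t+1}=\mathrm{AM}$ otherwise. Let $T=\inf\{t\ge 0\mid x_t=(1,\dots,1)\}$ be its runtime. There is an absolute constant hidden in the $O$-notation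 such that, for all such $n,m,p,q$ with \[ \frac{m}{2(n-2m)}\Bigl(q+\frac4n\Bigr)\ge p, \] we have \[ \mathrm{E}[T]=O\Bigl((1+pn)\Bigl(\frac1p+\frac1q\Bigr)\Bigl(n+\frac{n^m}{(m-1)!\,(1-q)^{m-2}}\Bigr)\Bigr). \] The condition on $p,q$ is satisfied whenever $\frac{m}{2n}q\ge p$. In particular, with implicit constants that depend only on $c$ in (1) and only on $c,d$ in (2): 1. If $q=\frac12$ and $p=\frac{m}{cn}q$ for some real $c\ge2$, then \[ \mathrm{E}[T]=O\Bigl(n^2+\frac{2^{m-2}n^{m+1}}{(m-1)!}\Bigr)=O(n^{m+1}). \] 2. If $q=\frac1{dm}$ and $p=\frac{m}{cn}q$ for some reals $c\ge2$ and $d\ge1$, then \[ \mathrm{E}[T]=O\Bigl(n^2+\frac{e^{1/d}\,n^{m+1}}{(m-1)!}\Bigr)=O\Bigl(\frac{n^{m+1}}{(m-1)!}\Bigr). \] -/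

import Mathlib

open MeasureTheory ProbabilityTheory
open scoped ENNReal Nat

namespace MMAHH

/-- Bit-strings of length `n`. -/
abbrev BitString (n : ℕ) : Type := Fin n → Bool

/-- `‖x‖₁`, the number of one-bits of `x`. -/
def numOnes {n : ℕ} (x : BitString n) : ℕ :=
  (Finset.univ.filter fun i => x i = true).card

/-- The all-ones string `x* = (1, …, 1)`. -/
def allOnes (n : ℕ) : BitString n := fun _ => true

/-- The benchmark `Jump_m` on bit-strings of length `n` (to be maximized). -/
noncomputable def jump (n m : ℕ) (x : BitString n) : ℝ :=
  if numOnes x + m ≤ n ∨ numOnes x = n then (m : ℝ) + numOnes x else (n : ℝ) - numOnes x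

/-- The two move-acceptance operators: only-improving and all-moves. -/
inductive AccOp : Type
  | OI
  | AM
  deriving DecidableEq

instance : Fintype AccOp := ⟨{AccOp.OI, AccOp.AM}, fun s => by cases s <;> decide⟩

instance : MeasurableSpace AccOp := ⊤

instance : DiscreteMeasurableSpace AccOp := ⟨fun _ => trivial⟩

/-- States of the algorithm: current bit-string and current acceptance operator. -/
abbrev State (n : ℕ) : Type := BitString n × AccOp

/-- The string `x` with bit `i` flipped. -/
def flipBit {n : ℕ} (x : BitString n) (i : Fin n) : BitString n :=
  Function.update x i (!x i)

/-- The next search point when the operator `s` judges the offspring `x'` of `x`. -/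
noncomputable def accept {n : ℕ} (f : BitString n → ℝ) :
    AccOp → BitString n → BitString n → BitString n
  | AccOp.OI, x, x' => if f x < f x' then x' else x
  | AccOp.AM, _, x' => x'

/-- One step of the operator chain: `OI` switches to `AM` with probability `p` and stays with
probability `1 - p`; `AM` switches to `OI` with probability `q` and stays with probability
`1 - q`. (`bernoulliMeasure a b r` gives mass `r` to `a` and mass `1 - r` to `b`.) -/
noncomputable def switch (p q : unitInterval) : AccOp → Measure AccOp
  | AccOp.OI => bernoulliMeasure AccOp.AM AccOp.OI p
  | AccOp.AM => bernoulliMeasure AccOp.OI AccOp.AM q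

instance (p q : unitInterval) (s : AccOp) : IsProbabilityMeasure (switch p q s) := by
  cases s <;> (unfold switch; infer_instance)

/-- One iteration of the algorithm: a uniformly random bit is flipped and the offspring is judged
by the current operator; independently, the operator is updated by the two-state chain. -/
noncomputable def stepKernel {n : ℕ} [NeZero n] (f : BitString n → ℝ) (p q : unitInterval) :
    Kernel (State n) (State n) :=
  Kernel.ofFunOfCountable fun z =>
    ((PMF.uniformOfFintype (Fin n)).map fun i => accept f z.2 z.1 (flipBit z.1 i)).toMeasure.prod
      (switch p q z.2)

instance {n : ℕ} [NeZero n] (f : BitString n → ℝ) (p q : unitInterval) :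
    IsMarkovKernel (stepKernel f p q) :=
  ⟨fun z => by
    change IsProbabilityMeasure (((PMF.uniformOfFintype (Fin n)).map
      fun i => accept f z.2 z.1 (flipBit z.1 i)).toMeasure.prod (switch p q z.2))
    infer_instance⟩

/-- The initial distribution: a uniformly random bit-string, and the operator `OI`. -/
noncomputable def initial (n : ℕ) : Measure (State n) :=
  (PMF.uniformOfFintype (BitString n)).toMeasure.prod (Measure.dirac AccOp.OI)

instance (n : ℕ) : IsProbabilityMeasure (initial n) := by
  unfold initial; infer_instance

/-- The law of the whole run `((x₀, s₀), (x₁, s₁), …)` of the algorithm on `f`: the time-homogeneous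
Markov chain with the above initial distribution and transition kernel. -/
noncomputable def law {n : ℕ} [NeZero n] (f : BitString n → ℝ) (p q : unitInterval) :
    Measure (ℕ → State n) :=
  Kernel.trajMeasure (X := fun _ => State n) (initial n) fun t =>
    (stepKernel f p q).comap (fun h => h ⟨t, Finset.mem_Iic.2 le_rfl⟩) (measurable_pi_apply _)

/-- The runtime `T = inf {t ≥ 0 | x_t = x*}` of a run (`∞` if `x*` is never reached). -/
noncomputable def runtime {n : ℕ} (ω : ℕ → State n) : ℝ≥0∞ :=
  ⨅ (t : ℕ) (_ : (ω t).1 = allOnes n), (t : ℝ≥0∞)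

/-- The expected runtime `E[T]` of the algorithm on `Jump_m`. -/
noncomputable def expectedRuntime (n m : ℕ) [NeZero n] (p q : unitInterval) : ℝ≥0∞ :=
  ∫⁻ ω, runtime ω ∂(law (jump n m) p q)

end MMAHH

/-!
Additive drift: if a nonnegative potential of the state drops on average by at least `1` in each
step before the optimum is found, then its initial value bounds `E[T]`.

On `Jump_m` the state may be reduced to the number `d` of zeros and the operator. The bottleneck is
the state `(m, AM)`: only from there is the valley crossed, by `m` consecutive improving moves
without switching back to `OI`, which happens with probability `ρ = m! / n^m * (1 - q)^(m - 2)`.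
Let `R` bound the expected time to return to `(m, AM)` and let `h` be the probability of a straight
descent to the optimum. The potential is `R + K * (1 - h)`: the drift condition for `R` is lost only
at `(m, AM)`, where one excursion costs `O(m * (1 + p * n) * (1 / p + 1 / q))` and `h` gains `ρ`, so
`K` is the ratio of the two.

Above level `m`, `OI` moves towards `m` while `AM` drifts towards `n / 2 > m`. The condition
relating `p` and `q` says that one `OI` phase makes up for the loss of one `AM` phase.
-/

namespace MMAHH

section MarkovChain

variable {X : Type*}

/-- The first time at which a run visits `A`, and `∞` if it never does. -/
noncomputable def hittingTime (A : Set X) (ω : ℕ → X) : ℝ≥0∞ :=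
  ⨅ (t : ℕ) (_ : ω t ∈ A), (t : ℝ≥0∞)

/-- The event that a run does not visit `A` up to and including time `t`. -/
def avoiding (A : Set X) (t : ℕ) : Set (ℕ → X) :=
  {ω | ∀ s ≤ t, ω s ∉ A}

lemma avoiding_eq_preimage_frestrictLe (A : Set X) (t : ℕ) :
    avoiding A t =
      Preorder.frestrictLe (π := fun _ => X) t ⁻¹' Set.univ.pi fun _ => Aᶜ := by
  ext ω
  simp [avoiding]

lemma avoiding_antitone (A : Set X) : Antitone (avoiding A) :=
  fun _ _ hst _ hω r hr => hω r (hr.trans hst)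

lemma hittingTime_le_tsum_indicator_avoiding (A : Set X) (ω : ℕ → X) :
    hittingTime A ω ≤ ∑' t, (avoiding A t).indicator 1 ω := by
  classical
  by_cases h : ∃ t, ω t ∈ A
  · calc hittingTime A ω ≤ Nat.find h := iInf₂_le (Nat.find h) (Nat.find_spec h)
      _ = ∑ t ∈ Finset.range (Nat.find h), (avoiding A t).indicator 1 ω := by
        have hmem : ∀ t ∈ Finset.range (Nat.find h), ω ∈ avoiding A t := fun t ht s hs =>
          Nat.find_min h (hs.trans_lt (Finset.mem_range.1 ht))
        rw [Finset.sum_congr rfl fun t ht => Set.indicator_of_mem (hmem t ht) 1]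
        simp
      _ ≤ ∑' t, (avoiding A t).indicator 1 ω := ENNReal.sum_le_tsum _
  · push Not at h
    have hmem : ∀ t, ω ∈ avoiding A t := fun t s _ => h s
    simp [hmem]

variable [MeasurableSpace X]

/-- The law of the time-homogeneous Markov chain with transition kernel `κ` and initial
distribution `μ`. -/
noncomputable def chainLaw (μ : Measure X) (κ : Kernel X X) [IsMarkovKernel κ] :
    Measure (ℕ → X) :=
  Kernel.trajMeasure (X := fun _ => X) μ fun t =>
    κ.comap (fun h => h ⟨t, Finset.mem_Iic.2 le_rfl⟩) (measurable_pi_apply _)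

instance (μ : Measure X) (κ : Kernel X X) [IsProbabilityMeasure μ] [IsMarkovKernel κ] :
    IsProbabilityMeasure (chainLaw μ κ) := by
  unfold chainLaw; infer_instance

lemma measurableSet_avoiding {A : Set X} (hA : MeasurableSet A) (t : ℕ) :
    MeasurableSet (avoiding A t) := by
  rw [avoiding_eq_preimage_frestrictLe]
  exact (MeasurableSet.univ_pi fun _ => hA.compl).preimage (by fun_prop)

variable {μ : Measure X} {κ : Kernel X X} [IsProbabilityMeasure μ] [IsMarkovKernel κ]
  {A : Set X} {G : X → ℝ≥0∞}

lemma setLIntegral_succ_chainLaw {t : ℕ} {S : Set ((i : Finset.Iic t) → X)}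
    (hS : MeasurableSet S) (hG : Measurable G) :
    ∫⁻ ω in Preorder.frestrictLe t ⁻¹' S, G (ω (t + 1)) ∂chainLaw μ κ =
      ∫⁻ ω in Preorder.frestrictLe t ⁻¹' S, ∫⁻ z, G z ∂κ (ω t) ∂chainLaw μ κ := by
  have hmarkov := Kernel.map_frestrictLe_trajMeasure_compProd_eq_map_trajMeasure
    (X := fun _ => X) (μ₀ := μ) (a := t)
    (κ := fun t => κ.comap (fun h => h ⟨t, Finset.mem_Iic.2 le_rfl⟩) (measurable_pi_apply _))
  have hG' : Measurable fun y : ((i : Finset.Iic t) → X) × X => G y.2 := hG.comp measurable_snd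
  calc ∫⁻ ω in Preorder.frestrictLe t ⁻¹' S, G (ω (t + 1)) ∂chainLaw μ κ
      = ∫⁻ y in S ×ˢ Set.univ, G y.2 ∂(chainLaw μ κ).map
          fun ω => (Preorder.frestrictLe (π := fun _ => X) t ω, ω (t + 1)) := by
        rw [setLIntegral_map (hS.prod MeasurableSet.univ) hG' (by fun_prop)]
        simp [Set.mk_preimage_prod]
    _ = ∫⁻ h in S, ∫⁻ z, G z ∂κ (h ⟨t, Finset.mem_Iic.2 le_rfl⟩)
          ∂(chainLaw μ κ).map (Preorder.frestrictLe (π := fun _ => X) t) := by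
        rw [chainLaw, ← hmarkov, Measure.setLIntegral_compProd hG' hS MeasurableSet.univ]
        simp
    _ = ∫⁻ ω in Preorder.frestrictLe t ⁻¹' S, ∫⁻ z, G z ∂κ (ω t) ∂chainLaw μ κ :=
        setLIntegral_map hS (hG.lintegral_kernel.comp (measurable_pi_apply _)) (by fun_prop)

lemma measure_avoiding_add_setLIntegral_succ_le (hA : MeasurableSet A) (hG : Measurable G)
    (hdrift : ∀ z ∉ A, 1 + ∫⁻ z', G z' ∂κ z ≤ G z) (t : ℕ) :
    chainLaw μ κ (avoiding A t) + ∫⁻ ω in avoiding A (t + 1), G (ω (t + 1)) ∂chainLaw μ κ ≤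
      ∫⁻ ω in avoiding A t, G (ω t) ∂chainLaw μ κ :=
  calc chainLaw μ κ (avoiding A t) + ∫⁻ ω in avoiding A (t + 1), G (ω (t + 1)) ∂chainLaw μ κ
      ≤ chainLaw μ κ (avoiding A t) + ∫⁻ ω in avoiding A t, G (ω (t + 1)) ∂chainLaw μ κ := by
        gcongr
        exact avoiding_antitone A t.le_succ
    _ = ∫⁻ ω in avoiding A t, (1 + ∫⁻ z, G z ∂κ (ω t)) ∂chainLaw μ κ := by
        rw [lintegral_add_left measurable_const, setLIntegral_one,
          avoiding_eq_preimage_frestrictLe,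
          setLIntegral_succ_chainLaw (MeasurableSet.univ_pi fun _ => hA.compl) hG]
    _ ≤ ∫⁻ ω in avoiding A t, G (ω t) ∂chainLaw μ κ :=
        setLIntegral_mono' (measurableSet_avoiding hA t) fun ω hω => hdrift _ (hω t le_rfl)

theorem lintegral_hittingTime_le_of_drift (hA : MeasurableSet A) (hG : Measurable G)
    (hdrift : ∀ z ∉ A, 1 + ∫⁻ z', G z' ∂κ z ≤ G z) :
    ∫⁻ ω, hittingTime A ω ∂chainLaw μ κ ≤ ∫⁻ ω, G (ω 0) ∂chainLaw μ κ := by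
  have hsum : ∀ N, ∑ t ∈ Finset.range N, chainLaw μ κ (avoiding A t) +
      ∫⁻ ω in avoiding A N, G (ω N) ∂chainLaw μ κ ≤ ∫⁻ ω, G (ω 0) ∂chainLaw μ κ := by
    intro N
    induction N with
    | zero => simpa using setLIntegral_le_lintegral _ _
    | succ N ih =>
      rw [Finset.sum_range_succ, add_assoc]
      grw [measure_avoiding_add_setLIntegral_succ_le hA hG hdrift N, ih]
  calc ∫⁻ ω, hittingTime A ω ∂chainLaw μ κ
      ≤ ∫⁻ ω, ∑' t, (avoiding A t).indicator 1 ω ∂chainLaw μ κ :=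
        lintegral_mono (hittingTime_le_tsum_indicator_avoiding A)
    _ = ∑' t, chainLaw μ κ (avoiding A t) := by
        rw [lintegral_tsum fun t =>
          (measurable_one.indicator (measurableSet_avoiding hA t)).aemeasurable]
        exact tsum_congr fun t => lintegral_indicator_one (measurableSet_avoiding hA t)
    _ ≤ ∫⁻ ω, G (ω 0) ∂chainLaw μ κ :=
        ENNReal.tsum_le_of_sum_range_le fun N => le_self_add.trans (hsum N)

end MarkovChain

section Levels

/-- The number of zero-bits of `x`, that is, its Hamming distance from the all-ones string. -/
def numZeros {n : ℕ} (x : BitString n) : ℕ :=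
  (Finset.univ.filter fun i => x i = false).card

lemma numOnes_add_numZeros {n : ℕ} (x : BitString n) : numOnes x + numZeros x = n := by
  simpa [numOnes, numZeros] using
    Finset.card_filter_add_card_filter_not (s := (Finset.univ : Finset (Fin n))) (x · = true)

lemma numZeros_le {n : ℕ} (x : BitString n) : numZeros x ≤ n := by
  have := numOnes_add_numZeros x
  omega

lemma numZeros_eq_zero_iff {n : ℕ} {x : BitString n} : numZeros x = 0 ↔ x = allOnes n := by
  simp [numZeros, Finset.filter_eq_empty_iff, funext_iff, allOnes]

lemma numZeros_flipBit_of_false {n : ℕ} {x : BitString n} {i : Fin n} (h : x i = false) :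
    numZeros (flipBit x i) + 1 = numZeros x := by
  have herase : (Finset.univ.filter fun j => flipBit x i j = false) =
      (Finset.univ.filter fun j => x j = false).erase i := by
    ext j
    by_cases hj : j = i <;> simp [flipBit, Function.update_apply, hj, h]
  rw [numZeros, herase, Finset.card_erase_add_one (by simp [h]), numZeros]

lemma numZeros_flipBit_of_true {n : ℕ} {x : BitString n} {i : Fin n} (h : x i = true) :
    numZeros (flipBit x i) = numZeros x + 1 := by
  have hinsert : (Finset.univ.filter fun j => flipBit x i j = false) =
      insert i (Finset.univ.filter fun j => x j = false) := by
    ext j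
    by_cases hj : j = i <;> simp [flipBit, Function.update_apply, hj, h]
  rw [numZeros, hinsert, Finset.card_insert_of_notMem (by simp [h]), numZeros]

/-- The common value of `Jump_m` on the strings of length `n` with exactly `d` zeros. -/
noncomputable def jumpLevel (n m d : ℕ) : ℝ :=
  if m ≤ d ∨ d = 0 then (m : ℝ) + n - d else d

lemma jump_eq_jumpLevel {n : ℕ} (m : ℕ) (x : BitString n) :
    jump n m x = jumpLevel n m (numZeros x) := by
  have h := numOnes_add_numZeros x
  have hreal : (numOnes x : ℝ) + numZeros x = n := mod_cast h
  have hiff : (numOnes x + m ≤ n ∨ numOnes x = n) ↔ (m ≤ numZeros x ∨ numZeros x = 0) := by omega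
  simp only [jump, jumpLevel, hiff]
  split_ifs <;> linarith

lemma jumpLevel_succ_lt_iff {n m d : ℕ} (hd : d < n) :
    jumpLevel n m (d + 1) < jumpLevel n m d ↔ m ≤ d ∨ d = 0 := by
  have hdn : (d : ℝ) + 1 ≤ n := mod_cast hd
  unfold jumpLevel
  push_cast
  by_cases hvalley : m ≤ d ∨ d = 0
  · rw [if_pos hvalley]
    simp only [hvalley, iff_true]
    split_ifs
    · linarith
    · obtain rfl : d = 0 := by omega
      have : (1 : ℝ) < m := mod_cast (by omega : 1 < m)
      push_cast
      linarith
  · rw [if_neg hvalley]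
    simp only [hvalley, iff_false, not_lt]
    split_ifs
    · have : (d : ℝ) + 1 ≤ m := mod_cast (by omega : d + 1 ≤ m)
      linarith
    · linarith

lemma jumpLevel_lt_succ_iff {n m d : ℕ} (h0 : 0 < d) (hd : d < n) :
    jumpLevel n m d < jumpLevel n m (d + 1) ↔ d < m := by
  have hdn : (d : ℝ) + 1 ≤ n := mod_cast hd
  unfold jumpLevel
  push_cast
  by_cases hvalley : d < m
  · rw [if_neg (by omega)]
    simp only [hvalley, iff_true]
    split_ifs
    · have : (d : ℝ) + 1 ≤ m := mod_cast hvalley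
      linarith
    · linarith
  · rw [if_pos (by omega), if_pos (by omega)]
    simp only [hvalley, iff_false, not_lt]
    linarith

/-- The number of zeros after an iteration with operator `s` that flips a zero-bit of a string
with `d` zeros. -/
def levelDown (m : ℕ) : AccOp → ℕ → ℕ
  | AccOp.OI, d => if m < d ∨ d = 1 then d - 1 else d
  | AccOp.AM, d => d - 1

/-- The number of zeros after an iteration with operator `s` that flips a one-bit of a string with
`d > 0` zeros. -/
def levelUp (m : ℕ) : AccOp → ℕ → ℕ
  | AccOp.OI, d => if d < m then d + 1 else d
  | AccOp.AM, d => d + 1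

lemma numZeros_accept_of_false {n m : ℕ} (s : AccOp) {x : BitString n} {i : Fin n}
    (h : x i = false) :
    numZeros (accept (jump n m) s x (flipBit x i)) = levelDown m s (numZeros x) := by
  have hz := numZeros_flipBit_of_false h
  have hn := numZeros_le x
  cases s with
  | AM => simp only [accept, levelDown]; omega
  | OI =>
    have hiff : jump n m x < jump n m (flipBit x i) ↔ m < numZeros x ∨ numZeros x = 1 := by
      rw [jump_eq_jumpLevel, jump_eq_jumpLevel, ← hz, jumpLevel_succ_lt_iff (by omega)]
      omega
    simp only [accept, levelDown, hiff]
    split_ifs <;> omega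

lemma numZeros_accept_of_true {n m : ℕ} (s : AccOp) {x : BitString n} (hx : 0 < numZeros x)
    {i : Fin n} (h : x i = true) :
    numZeros (accept (jump n m) s x (flipBit x i)) = levelUp m s (numZeros x) := by
  have hz := numZeros_flipBit_of_true h
  have hn := numZeros_le (flipBit x i)
  cases s with
  | AM => simp only [accept, levelUp, hz]
  | OI =>
    have hiff : jump n m x < jump n m (flipBit x i) ↔ numZeros x < m := by
      rw [jump_eq_jumpLevel, jump_eq_jumpLevel, hz, jumpLevel_lt_succ_iff hx (by omega)]
    simp only [accept, levelUp, hiff]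
    split_ifs <;> omega

end Levels

section Drift

/-- The expectation of `F` after one step of the operator chain started in `s`. -/
noncomputable def opMean (p q : unitInterval) (F : AccOp → ℝ) : AccOp → ℝ
  | AccOp.OI => p * F AccOp.AM + (1 - p) * F AccOp.OI
  | AccOp.AM => q * F AccOp.OI + (1 - q) * F AccOp.AM

/-- The expectation of `Φ (number of zeros) (operator)` after one iteration on `Jump_m` started
with `d > 0` zeros and operator `s`. -/
noncomputable def levelMean (n m : ℕ) (p q : unitInterval) (Φ : ℕ → AccOp → ℝ) (d : ℕ)
    (s : AccOp) : ℝ :=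
  (d : ℝ) / n * opMean p q (Φ (levelDown m s d)) s +
    (1 - (d : ℝ) / n) * opMean p q (Φ (levelUp m s d)) s

variable {n m : ℕ} {p q : unitInterval}

lemma opMean_le {F : AccOp → ℝ} {b : ℝ} (hF : ∀ s, F s ≤ b) (s : AccOp) : opMean p q F s ≤ b := by
  have hp := p.2
  have hq := q.2
  cases s <;> simp only [opMean] <;> nlinarith [hF AccOp.OI, hF AccOp.AM, hp.1, hp.2, hq.1, hq.2]

lemma opMean_nonneg {F : AccOp → ℝ} (hF : ∀ s, 0 ≤ F s) (s : AccOp) : 0 ≤ opMean p q F s := by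
  cases s
  · exact add_nonneg (mul_nonneg p.2.1 (hF _)) (mul_nonneg (sub_nonneg.2 p.2.2) (hF _))
  · exact add_nonneg (mul_nonneg q.2.1 (hF _)) (mul_nonneg (sub_nonneg.2 q.2.2) (hF _))

lemma levelMean_nonneg {Φ : ℕ → AccOp → ℝ} (hΦ : ∀ d s, 0 ≤ Φ d s) {d : ℕ} (hd : d ≤ n)
    (s : AccOp) : 0 ≤ levelMean n m p q Φ d s := by
  have hdn : (d : ℝ) / n ≤ 1 := div_le_one_of_le₀ (mod_cast hd) n.cast_nonneg
  exact add_nonneg (mul_nonneg (by positivity) (opMean_nonneg (hΦ _) s))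
    (mul_nonneg (sub_nonneg.2 hdn) (opMean_nonneg (hΦ _) s))

lemma levelMean_le {Φ : ℕ → AccOp → ℝ} {d : ℕ} {s : AccOp} {b c : ℝ} (hd : d ≤ n)
    (hdown : ∀ s', Φ (levelDown m s d) s' ≤ b) (hup : ∀ s', Φ (levelUp m s d) s' ≤ c) :
    levelMean n m p q Φ d s ≤ (d : ℝ) / n * b + (1 - (d : ℝ) / n) * c := by
  have hdn : 0 ≤ 1 - (d : ℝ) / n :=
    sub_nonneg.2 (div_le_one_of_le₀ (mod_cast hd) n.cast_nonneg)
  exact add_le_add (mul_le_mul_of_nonneg_left (opMean_le hdown s) (by positivity))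
    (mul_le_mul_of_nonneg_left (opMean_le hup s) hdn)

lemma integral_switch (F : AccOp → ℝ) (s : AccOp) :
    ∫ s', F s' ∂switch p q s = opMean p q F s := by
  cases s <;> simp [switch, opMean, integral_bernoulliMeasure]

variable [NeZero n]

lemma integral_stepKernel (f : BitString n → ℝ) (F : State n → ℝ) (z : State n) :
    ∫ z', F z' ∂stepKernel f p q z =
      ∑ i, (n : ℝ)⁻¹ * opMean p q (fun s => F (accept f z.2 z.1 (flipBit z.1 i), s)) z.2 := by
  change ∫ z', F z' ∂((PMF.uniformOfFintype (Fin n)).map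
    fun i => accept f z.2 z.1 (flipBit z.1 i)).toMeasure.prod (switch p q z.2) = _
  rw [integral_prod _ .of_finite, ← PMF.toMeasure_map _ _ (by fun_prop),
    integral_map (by fun_prop) (measurable_of_countable _).aestronglyMeasurable,
    PMF.integral_eq_sum]
  simp [integral_switch]

lemma integral_stepKernel_jump (Φ : ℕ → AccOp → ℝ) {z : State n} (hz : 0 < numZeros z.1) :
    ∫ z', Φ (numZeros z'.1) z'.2 ∂stepKernel (jump n m) p q z =
      levelMean n m p q Φ (numZeros z.1) z.2 := by
  obtain ⟨x, s⟩ := z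
  have hmean : ∀ i, opMean p q (Φ (numZeros (accept (jump n m) s x (flipBit x i)))) s =
      if x i = false then opMean p q (Φ (levelDown m s (numZeros x))) s
        else opMean p q (Φ (levelUp m s (numZeros x))) s := by
    intro i
    split_ifs with hi
    · rw [numZeros_accept_of_false s hi]
    · rw [numZeros_accept_of_true s hz (by simpa using hi)]
  have hones : ((Finset.univ.filter fun i => ¬x i = false).card : ℝ) = n - numZeros x := by
    rw [eq_sub_iff_add_eq, show (Finset.univ.filter fun i => ¬x i = false).card = numOnes x by
      simp [numOnes]]
    exact_mod_cast numOnes_add_numZeros x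
  have hn : (n : ℝ) ≠ 0 := NeZero.ne _
  rw [integral_stepKernel, ← Finset.mul_sum]
  simp only [hmean]
  rw [Finset.sum_ite, Finset.sum_const, Finset.sum_const, nsmul_eq_mul, nsmul_eq_mul, hones,
    levelMean, ← numZeros]
  field_simp

theorem expectedRuntime_le_of_levelMean_le {Φ : ℕ → AccOp → ℝ} (hΦ : ∀ d s, 0 ≤ Φ d s)
    (hdrift : ∀ d s, 0 < d → d ≤ n → 1 + levelMean n m p q Φ d s ≤ Φ d s)
    {B : ℝ} (hB : ∀ d s, d ≤ n → Φ d s ≤ B) :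
    expectedRuntime n m p q ≤ ENNReal.ofReal B := by
  let G : State n → ℝ≥0∞ := fun z => ENNReal.ofReal (Φ (numZeros z.1) z.2)
  have hG : ∀ z ∉ {z : State n | z.1 = allOnes n},
      1 + ∫⁻ z', G z' ∂stepKernel (jump n m) p q z ≤ G z := by
    intro z hz
    have hz0 : 0 < numZeros z.1 := Nat.pos_of_ne_zero fun h => hz (numZeros_eq_zero_iff.1 h)
    rw [← ofReal_integral_eq_lintegral_ofReal .of_finite (ae_of_all _ fun z' => hΦ _ _),
      integral_stepKernel_jump Φ hz0, ← ENNReal.ofReal_one,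
      ← ENNReal.ofReal_add zero_le_one (levelMean_nonneg hΦ (numZeros_le _) _)]
    exact ENNReal.ofReal_le_ofReal (hdrift _ _ hz0 (numZeros_le _))
  calc expectedRuntime n m p q
      ≤ ∫⁻ ω, G (ω 0) ∂chainLaw (initial n) (stepKernel (jump n m) p q) :=
        lintegral_hittingTime_le_of_drift (Set.to_countable _).measurableSet
          (measurable_of_countable G) hG
    _ ≤ ∫⁻ _, ENNReal.ofReal B ∂chainLaw (initial n) (stepKernel (jump n m) p q) :=
        lintegral_mono fun ω => ENNReal.ofReal_le_ofReal (hB _ _ (numZeros_le _))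
    _ = ENNReal.ofReal B := by simp

/-- Here `R` plays the role of the time to return to some base state, `h` that of the probability
to finish before doing so, and `K` that of the expected time lost in unsuccessful excursions. -/
theorem expectedRuntime_le_add {R h : ℕ → AccOp → ℝ} {B K : ℝ} (hR : ∀ d s, 0 ≤ R d s)
    (hRB : ∀ d s, d ≤ n → R d s ≤ B) (h0 : ∀ d s, 0 ≤ h d s) (h1 : ∀ d s, h d s ≤ 1) (hK : 0 ≤ K)
    (hdrift : ∀ d s, 0 < d → d ≤ n →
      1 + levelMean n m p q R d s + K * h d s ≤ R d s + K * levelMean n m p q h d s) :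
    expectedRuntime n m p q ≤ ENNReal.ofReal (B + K) := by
  have hlin : ∀ d s, levelMean n m p q (fun d s => R d s + K * (1 - h d s)) d s =
      levelMean n m p q R d s + K * (1 - levelMean n m p q h d s) := by
    intro d s
    cases s <;> simp only [levelMean, opMean] <;> ring
  refine expectedRuntime_le_of_levelMean_le (Φ := fun d s => R d s + K * (1 - h d s))
    (fun d s => add_nonneg (hR d s) (mul_nonneg hK (sub_nonneg.2 (h1 d s))))
    (fun d s hd hdn => ?_) fun d s hd => add_le_add (hRB d s hd) ?_
  · rw [hlin]
    linarith [hdrift d s hd hdn]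
  · exact mul_le_of_le_one_right hK (sub_le_self 1 (h0 d s))

end Drift

section ReturnPotential

/-- The mean duration of an `OI` phase together with the following `AM` phase. -/
noncomputable def cycleLength (p q : unitInterval) : ℝ :=
  1 / p + 1 / q

/-- The cost per zero above level `m` in the return potential. Under `AM` the mean distance to
`n / 2` shrinks by the factor `1 - 2 / n` in each iteration, so the `AM` slope is the fixed point of
`α = (1 - 2 / n) * ((1 - q) * α + q * slope OI)`. -/
noncomputable def slope (n : ℕ) (p q : unitInterval) : AccOp → ℝ
  | AccOp.OI => n * p * cycleLength p q
  | AccOp.AM => (1 - 2 / n) *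
      (q * (n * p * cycleLength p q) / (1 - (1 - q) * (1 - 2 / (n : ℝ))))

/-- The return potential below level `m`, where both operators tend to push the search point back to
level `m`. -/
noncomputable def valleyPotential (m : ℕ) (p : unitInterval) (d : ℕ) : ℝ :=
  ((m : ℝ) * (m + 1) - d * (d + 1)) / 2 + 1 / p

/-- An upper bound for the expected time to reach the local optimum, that is `m` zeros, with
operator `AM`, when starting with `d` zeros and operator `s`. -/
noncomputable def returnPotential (n m : ℕ) (p q : unitInterval) (d : ℕ) : AccOp → ℝ
  | AccOp.OI => if d < m then valleyPotential m p d else slope n p q AccOp.OI * (d - m) + 1 / p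
  | AccOp.AM => if d < m then valleyPotential m p d else if d = m then 0 else
      slope n p q AccOp.AM * (d - m) + (m + 1) * cycleLength p q

variable {n m d : ℕ} {p q : unitInterval}

lemma cycleLength_nonneg : 0 ≤ cycleLength p q :=
  add_nonneg (one_div_nonneg.2 p.2.1) (one_div_nonneg.2 q.2.1)

lemma one_div_le_cycleLength : 1 / (p : ℝ) ≤ cycleLength p q :=
  le_add_of_nonneg_right (one_div_nonneg.2 q.2.1)

lemma one_le_cycleLength (hp : (0 : ℝ) < p) : 1 ≤ cycleLength p q :=
  ((one_le_div hp).2 p.2.2).trans one_div_le_cycleLength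

lemma slope_OI_nonneg : 0 ≤ slope n p q AccOp.OI :=
  mul_nonneg (mul_nonneg n.cast_nonneg p.2.1) cycleLength_nonneg

lemma le_slope_OI (hp : (0 : ℝ) < p) : (n : ℝ) ≤ slope n p q AccOp.OI := by
  have hpq : (p : ℝ) * (1 / p) ≤ p * cycleLength p q :=
    mul_le_mul_of_nonneg_left one_div_le_cycleLength p.2.1
  rw [mul_one_div_cancel hp.ne'] at hpq
  rw [slope, mul_assoc]
  exact le_mul_of_one_le_right n.cast_nonneg hpq

lemma one_add_mul_cycleLength :
    (1 + (p : ℝ) * n) * cycleLength p q = cycleLength p q + slope n p q AccOp.OI := by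
  simp only [slope]
  ring

lemma two_div_le_one (hn : 2 ≤ n) : 2 / (n : ℝ) ≤ 1 :=
  div_le_one_of_le₀ (mod_cast hn) n.cast_nonneg

lemma slope_denom_pos (hn : 2 ≤ n) : 0 < 1 - (1 - (q : ℝ)) * (1 - 2 / n) := by
  have hpos : 0 < 2 / (n : ℝ) := div_pos two_pos (mod_cast (by omega : 0 < n))
  nlinarith [mul_nonneg q.2.1 (sub_nonneg.2 (two_div_le_one hn))]

lemma slope_AM_nonneg (hn : 2 ≤ n) : 0 ≤ slope n p q AccOp.AM :=
  mul_nonneg (sub_nonneg.2 (two_div_le_one hn))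
    (div_nonneg (mul_nonneg q.2.1 slope_OI_nonneg) (slope_denom_pos hn).le)

lemma slope_AM_le_slope_OI (hn : 2 ≤ n) : slope n p q AccOp.AM ≤ slope n p q AccOp.OI := by
  have hdenom : (1 - 2 / (n : ℝ)) * q ≤ 1 - (1 - q) * (1 - 2 / n) := by
    have : 0 ≤ 2 / (n : ℝ) := by positivity
    linarith
  calc slope n p q AccOp.AM
      = slope n p q AccOp.OI * ((1 - 2 / (n : ℝ)) * q / (1 - (1 - q) * (1 - 2 / n))) := by
        simp only [slope]
        ring
    _ ≤ slope n p q AccOp.OI :=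
        mul_le_of_le_one_right slope_OI_nonneg ((div_le_one (slope_denom_pos hn)).2 hdenom)

lemma opMean_slope_AM (hn : 2 ≤ n) :
    opMean p q (slope n p q) AccOp.AM =
      q * (n * p * cycleLength p q) / (1 - (1 - q) * (1 - 2 / n)) := by
  have hdenom := (slope_denom_pos (q := q) hn).ne'
  simp only [opMean, slope]
  generalize 2 / (n : ℝ) = y at hdenom
  field_simp
  ring

lemma slope_AM_eq (hn : 2 ≤ n) :
    slope n p q AccOp.AM = (1 - 2 / n) * opMean p q (slope n p q) AccOp.AM := by
  rw [opMean_slope_AM hn, slope]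

lemma opMean_slope_AM_mul_le (hm : 1 < m) (hmn : 2 * m < n)
    (hpq : (p : ℝ) ≤ m / (2 * (n - 2 * m)) * (q + 4 / n)) :
    opMean p q (slope n p q) AccOp.AM * (1 - 2 * m / n) ≤ q * (m * cycleLength p q) := by
  have hn : (0 : ℝ) < n := mod_cast (by omega : 0 < n)
  have hgap : 0 < (n : ℝ) - 2 * m := sub_pos.2 (mod_cast hmn)
  have hD := slope_denom_pos (q := q) (by omega : 2 ≤ n)
  have hhalf : 2 / (n : ℝ) ≤ 1 / 2 := by
    rw [div_le_div_iff₀ hn two_pos]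
    exact_mod_cast (by omega : 2 * 2 ≤ 1 * n)
  have hdenom : q / 2 + 2 / (n : ℝ) ≤ 1 - (1 - q) * (1 - 2 / n) := by
    nlinarith [mul_nonneg q.2.1 (sub_nonneg.2 hhalf)]
  have hcond : (p : ℝ) * (n - 2 * m) ≤ m * (1 - (1 - q) * (1 - 2 / n)) :=
    calc (p : ℝ) * (n - 2 * m) ≤ m / (2 * (n - 2 * m)) * (q + 4 / n) * (n - 2 * m) := by gcongr
      _ = m * (q / 2 + 2 / n) := by
        generalize (n : ℝ) - 2 * m = t at hgap
        field_simp
        ring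
      _ ≤ m * (1 - (1 - q) * (1 - 2 / n)) := by gcongr
  rw [opMean_slope_AM (by omega), div_mul_eq_mul_div, div_le_iff₀ hD]
  calc (q : ℝ) * (n * p * cycleLength p q) * (1 - 2 * m / n)
      = q * cycleLength p q * (p * (n - 2 * m)) := by field_simp
    _ ≤ q * cycleLength p q * (m * (1 - (1 - q) * (1 - 2 / n))) :=
        mul_le_mul_of_nonneg_left hcond (mul_nonneg q.2.1 cycleLength_nonneg)
    _ = q * (m * cycleLength p q) * (1 - (1 - q) * (1 - 2 / n)) := by ring

lemma valleyPotential_antitone : Antitone (valleyPotential m p) := by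
  intro d e hde
  unfold valleyPotential
  gcongr

lemma valleyPotential_self : valleyPotential m p m = 1 / p := by
  simp [valleyPotential]

lemma valleyPotential_nonneg (h : d ≤ m) : 0 ≤ valleyPotential m p d :=
  (one_div_nonneg.2 p.2.1).trans (valleyPotential_self.symm.le.trans (valleyPotential_antitone h))

lemma valleyPotential_drift (h0 : 0 < d) (hdn : 2 * d < n) :
    1 + ((d : ℝ) / n * valleyPotential m p (d - 1) +
      (1 - (d : ℝ) / n) * valleyPotential m p (d + 1)) ≤ valleyPotential m p d := by
  have hn : (0 : ℝ) < n := mod_cast (by omega : 0 < n)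
  have hfrac : (d : ℝ) / n * (2 * d + 1) ≤ d := by
    rw [div_mul_eq_mul_div, div_le_iff₀ hn]
    exact mod_cast Nat.mul_le_mul_left d hdn
  simp only [valleyPotential, Nat.cast_pred h0, Nat.cast_add_one]
  linarith

lemma returnPotential_of_lt (h : d < m) (s : AccOp) :
    returnPotential n m p q d s = valleyPotential m p d := by
  cases s <;> simp [returnPotential, h]

lemma returnPotential_OI_of_ge (h : m ≤ d) :
    returnPotential n m p q d AccOp.OI = slope n p q AccOp.OI * (d - m) + 1 / p := by
  simp [returnPotential, h.not_gt]

lemma returnPotential_AM_self : returnPotential n m p q m AccOp.AM = 0 := by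
  simp [returnPotential]

lemma returnPotential_AM_of_gt (h : m < d) :
    returnPotential n m p q d AccOp.AM =
      slope n p q AccOp.AM * (d - m) + (m + 1) * cycleLength p q := by
  simp [returnPotential, h.not_gt, h.ne']

lemma returnPotential_le_valleyPotential (h : d ≤ m) (s : AccOp) :
    returnPotential n m p q d s ≤ valleyPotential m p d := by
  rcases h.eq_or_lt with rfl | h
  · cases s
    · simp [returnPotential_OI_of_ge le_rfl, valleyPotential_self]
    · rw [returnPotential_AM_self]
      exact valleyPotential_nonneg le_rfl
  · exact (returnPotential_of_lt h s).le

lemma returnPotential_AM_le (h : m ≤ d) :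
    returnPotential n m p q d AccOp.AM ≤
      slope n p q AccOp.AM * (d - m) + (m + 1) * cycleLength p q := by
  rcases h.eq_or_lt with rfl | h
  · rw [returnPotential_AM_self, sub_self, mul_zero, zero_add]
    exact mul_nonneg (by positivity) cycleLength_nonneg
  · exact (returnPotential_AM_of_gt h).le

lemma returnPotential_nonneg (hn : 2 ≤ n) (d : ℕ) (s : AccOp) :
    0 ≤ returnPotential n m p q d s := by
  rcases lt_or_ge d m with h | h
  · rw [returnPotential_of_lt h]
    exact valleyPotential_nonneg h.le
  have hdm : (0 : ℝ) ≤ d - m := sub_nonneg.2 (mod_cast h)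
  cases s with
  | OI =>
    rw [returnPotential_OI_of_ge h]
    exact add_nonneg (mul_nonneg slope_OI_nonneg hdm) (one_div_nonneg.2 p.2.1)
  | AM =>
    rcases h.eq_or_lt with rfl | h
    · exact returnPotential_AM_self.ge
    · rw [returnPotential_AM_of_gt h]
      exact add_nonneg (mul_nonneg (slope_AM_nonneg hn) hdm)
        (mul_nonneg (by positivity) cycleLength_nonneg)

lemma returnPotential_le_of_ge (hn : 2 ≤ n) (h : m ≤ d) (s : AccOp) :
    returnPotential n m p q d s ≤
      slope n p q AccOp.OI * (d - m) + (m + 1) * cycleLength p q := by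
  have hdm : (0 : ℝ) ≤ d - m := sub_nonneg.2 (mod_cast h)
  cases s with
  | OI =>
    rw [returnPotential_OI_of_ge h]
    gcongr
    exact one_div_le_cycleLength.trans
      (le_mul_of_one_le_left cycleLength_nonneg (le_add_of_nonneg_left m.cast_nonneg))
  | AM =>
    refine (returnPotential_AM_le h).trans ?_
    gcongr
    exact slope_AM_le_slope_OI hn

lemma returnPotential_le (hm : 0 < m) (hmn : m < n) (hp : (0 : ℝ) < p) (hd : d ≤ n) (s : AccOp) :
    returnPotential n m p q d s ≤ n * ((1 + (p : ℝ) * n) * cycleLength p q) := by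
  have hσ := one_div_le_cycleLength (p := p) (q := q)
  have hσ0 := cycleLength_nonneg (p := p) (q := q)
  have ha0 := slope_OI_nonneg (n := n) (p := p) (q := q)
  have hmn' : (m : ℝ) + 1 ≤ n := mod_cast hmn
  have hm' : (1 : ℝ) ≤ m := mod_cast hm
  rw [one_add_mul_cycleLength, mul_add]
  rcases lt_or_ge d m with h | h
  · rw [returnPotential_of_lt h]
    calc valleyPotential m p d ≤ valleyPotential m p 0 := valleyPotential_antitone d.zero_le
      _ = m * (m + 1) / 2 + 1 / p := by simp [valleyPotential]
      _ ≤ n * n + n * cycleLength p q := by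
        gcongr ?_ + ?_ <;> nlinarith
      _ ≤ n * slope n p q AccOp.OI + n * cycleLength p q := by
        gcongr
        exact le_slope_OI hp
      _ = _ := add_comm _ _
  · have hdn : (d : ℝ) ≤ n := mod_cast hd
    refine (returnPotential_le_of_ge (by omega) h s).trans ?_
    rw [add_comm, mul_comm (slope _ _ _ _)]
    gcongr
    linarith

lemma levelMean_returnPotential_of_lt (hmn : 2 * m ≤ n) (h0 : 0 < d) (h : d < m) (s : AccOp) :
    1 + levelMean n m p q (returnPotential n m p q) d s ≤ returnPotential n m p q d s := by
  have hup : levelUp m s d = d + 1 := by cases s <;> simp [levelUp, h]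
  have hdown : d - 1 ≤ levelDown m s d ∧ levelDown m s d ≤ m := by
    cases s <;> simp only [levelDown] <;> [split_ifs; skip] <;> omega
  have hmean := levelMean_le (n := n) (p := p) (q := q) (by omega)
    (fun s' => (returnPotential_le_valleyPotential (n := n) (p := p) (q := q) hdown.2 s').trans
      (valleyPotential_antitone hdown.1))
    (fun s' => (congrArg (returnPotential n m p q · s') hup).trans_le
      (returnPotential_le_valleyPotential h s'))
  rw [returnPotential_of_lt h]
  exact (add_le_add_right hmean 1).trans (valleyPotential_drift h0 (by omega))

lemma levelMean_returnPotential_self_OI (hm : 1 < m) (hp : (0 : ℝ) < p) :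
    1 + levelMean n m p q (returnPotential n m p q) m AccOp.OI =
      returnPotential n m p q m AccOp.OI := by
  have hdown : levelDown m AccOp.OI m = m := by simp [levelDown, hm.ne']
  have hup : levelUp m AccOp.OI m = m := by simp [levelUp]
  rw [levelMean, hdown, hup, opMean, returnPotential_AM_self, returnPotential_OI_of_ge le_rfl]
  field_simp
  ring

lemma levelMean_returnPotential_self_AM (hm : 1 < m) (hmn : 2 * m < n) (hp : (0 : ℝ) < p) :
    1 + levelMean n m p q (returnPotential n m p q) m AccOp.AM ≤
      2 * m * ((1 + (p : ℝ) * n) * cycleLength p q) := by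
  have hσ := one_le_cycleLength (q := q) hp
  have hna := le_slope_OI (n := n) (q := q) hp
  have hm' : (2 : ℝ) ≤ m := mod_cast hm
  have hmn' : 2 * (m : ℝ) ≤ n := mod_cast hmn.le
  have hdown : ∀ s, returnPotential n m p q (m - 1) s ≤
      slope n p q AccOp.OI + (m + 1) * cycleLength p q := by
    intro s
    have hp' := one_div_le_cycleLength (p := p) (q := q)
    rw [returnPotential_of_lt (by omega), valleyPotential, Nat.cast_pred (by omega)]
    nlinarith
  have hup : ∀ s, returnPotential n m p q (m + 1) s ≤
      slope n p q AccOp.OI + (m + 1) * cycleLength p q := by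
    intro s
    simpa using returnPotential_le_of_ge (n := n) (p := p) (q := q) (by omega) m.le_succ s
  have hmean := levelMean_le (n := n) (m := m) (p := p) (q := q) (s := AccOp.AM) (by omega)
    hdown hup
  rw [← add_mul, add_sub_cancel, one_mul] at hmean
  rw [one_add_mul_cycleLength]
  nlinarith

lemma levelMean_returnPotential_OI_of_gt (hn : 2 ≤ n) (hm : 0 < m) (hp : (0 : ℝ) < p) (hd : m < d)
    (hdn : d ≤ n) :
    1 + levelMean n m p q (returnPotential n m p q) d AccOp.OI ≤
      returnPotential n m p q d AccOp.OI := by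
  have hx1 : (d : ℝ) / n ≤ 1 := div_le_one_of_le₀ (mod_cast hdn) n.cast_nonneg
  have hmd : (m : ℝ) + 1 ≤ d := mod_cast hd
  have hdown : levelDown m AccOp.OI d = d - 1 := by simp [levelDown, hd]
  have hup : levelUp m AccOp.OI d = d := by simp [levelUp, hd.not_gt]
  have hfall : (d : ℝ) / n * (p * returnPotential n m p q (d - 1) AccOp.AM) ≤
      d / n * (p * (slope n p q AccOp.AM * (d - 1 - m) + (m + 1) * cycleLength p q)) := by
    gcongr
    simpa [Nat.cast_pred (by omega : 0 < d)] using
      returnPotential_AM_le (n := n) (p := p) (q := q) (by omega : m ≤ d - 1)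
  have hslope : 0 ≤ p * (slope n p q AccOp.OI - slope n p q AccOp.AM) * (d - m - d / n) :=
    mul_nonneg (mul_nonneg hp.le (sub_nonneg.2 (slope_AM_le_slope_OI hn))) (by linarith)
  have hgain : (p : ℝ) * ((m + 1) * cycleLength p q) ≤ slope n p q AccOp.OI * ((d : ℝ) / n) := by
    have : (0 : ℝ) < n := mod_cast (by omega : 0 < n)
    calc (p : ℝ) * ((m + 1) * cycleLength p q) ≤ p * (d * cycleLength p q) := by
          gcongr
          exact cycleLength_nonneg
      _ = slope n p q AccOp.OI * ((d : ℝ) / n) := by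
        simp only [slope]
        field_simp
  have hinv : (p : ℝ) * (1 / p) = 1 := mul_one_div_cancel hp.ne'
  rw [levelMean, hdown, hup, opMean, opMean, returnPotential_OI_of_ge (by omega),
    returnPotential_OI_of_ge (by omega), returnPotential_AM_of_gt hd, Nat.cast_pred (by omega)]
  linear_combination hfall + hslope + hgain - hinv

lemma levelMean_returnPotential_AM_of_gt (hm : 1 < m) (hmn : 2 * m < n) (hq : (0 : ℝ) < q)
    (hpq : (p : ℝ) ≤ m / (2 * (n - 2 * m)) * (q + 4 / n)) (hd : m < d) :
    1 + levelMean n m p q (returnPotential n m p q) d AccOp.AM ≤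
      returnPotential n m p q d AccOp.AM := by
  have hfall : (d : ℝ) / n * ((1 - q) * returnPotential n m p q (d - 1) AccOp.AM) ≤
      d / n * ((1 - q) * (slope n p q AccOp.AM * (d - 1 - m) + (m + 1) * cycleLength p q)) := by
    have hq1 : 0 ≤ 1 - (q : ℝ) := sub_nonneg.2 q.2.2
    gcongr
    simpa [Nat.cast_pred (by omega : 0 < d)] using
      returnPotential_AM_le (n := n) (p := p) (q := q) (by omega : m ≤ d - 1)
  have hslope := slope_AM_eq (p := p) (q := q) (by omega : 2 ≤ n)
  have hclimb := opMean_slope_AM_mul_le hm hmn hpq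
  have hcycle : q * cycleLength p q = q * (1 / p) + 1 := by
    rw [cycleLength, mul_add, mul_one_div_cancel hq.ne']
  rw [levelMean, levelDown, levelUp, opMean, opMean, returnPotential_OI_of_ge (by omega),
    returnPotential_OI_of_ge (by omega), returnPotential_AM_of_gt hd,
    returnPotential_AM_of_gt (by omega : m < d + 1), Nat.cast_pred (by omega), Nat.cast_add_one]
  rw [opMean] at hslope hclimb
  linear_combination hfall - (d - m : ℝ) * hslope + hclimb - hcycle

lemma levelMean_returnPotential_le (hm : 1 < m) (hmn : 2 * m < n) (hp : (0 : ℝ) < p)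
    (hq : (0 : ℝ) < q) (hpq : (p : ℝ) ≤ m / (2 * (n - 2 * m)) * (q + 4 / n)) (h0 : 0 < d)
    (hdn : d ≤ n) {s : AccOp} (hds : ¬(d = m ∧ s = AccOp.AM)) :
    1 + levelMean n m p q (returnPotential n m p q) d s ≤ returnPotential n m p q d s := by
  rcases lt_trichotomy d m with h | rfl | h
  · exact levelMean_returnPotential_of_lt hmn.le h0 h s
  · cases s with
    | OI => exact (levelMean_returnPotential_self_OI hm hp).le
    | AM => simp at hds
  · cases s with
    | OI => exact levelMean_returnPotential_OI_of_gt (by omega) (by omega) hp h hdn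
    | AM => exact levelMean_returnPotential_AM_of_gt hm hmn hq hpq h

end ReturnPotential

section Descent

/-- The probability that `AM` leads from `d` zeros to the all-ones string by `d` consecutive
improving moves. The operator does not matter at levels `0` and `1`, hence the exponent `d - 2`. -/
noncomputable def descentWeight (n : ℕ) (q : unitInterval) (d : ℕ) : ℝ :=
  (d ! : ℝ) / (n : ℝ) ^ d * (1 - q) ^ (d - 2)

/-- A lower bound for the probability to reach the all-ones string from `d` zeros and operator `s`
before returning to the local optimum. -/
noncomputable def descentProb (n m : ℕ) (q : unitInterval) (d : ℕ) : AccOp → ℝ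
  | AccOp.OI => if d ≤ 1 then descentWeight n q d else 0
  | AccOp.AM => if d < m then descentWeight n q d else 0

variable {n m d : ℕ} {p q : unitInterval}

lemma descentWeight_nonneg : 0 ≤ descentWeight n q d :=
  mul_nonneg (by positivity) (pow_nonneg (sub_nonneg.2 q.2.2) _)

lemma descentWeight_le_one (hd : d ≤ n) : descentWeight n q d ≤ 1 :=
  mul_le_one₀
    (div_le_one_of_le₀ (mod_cast (Nat.factorial_le_pow d).trans (Nat.pow_le_pow_left hd d))
      (by positivity))
    (pow_nonneg (sub_nonneg.2 q.2.2) _)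
    (pow_le_one₀ (sub_nonneg.2 q.2.2) (sub_le_self 1 q.2.1))

lemma pow_div_mul_descentWeight [NeZero n] (hm : 0 < m) (hq : (q : ℝ) < 1) :
    (n : ℝ) ^ m / (((m - 1)! : ℕ) * (1 - q) ^ (m - 2)) * descentWeight n q m = m := by
  have hn : (n : ℝ) ^ m ≠ 0 := pow_ne_zero _ (NeZero.ne _)
  have hfac : (((m - 1)! : ℕ) : ℝ) ≠ 0 := mod_cast (m - 1).factorial_ne_zero
  have hpow : (1 - (q : ℝ)) ^ (m - 2) ≠ 0 := pow_ne_zero _ (sub_pos.2 hq).ne'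
  rw [descentWeight, ← Nat.mul_factorial_pred hm.ne', Nat.cast_mul]
  field_simp

lemma descentProb_nonneg (d : ℕ) (s : AccOp) : 0 ≤ descentProb n m q d s := by
  cases s <;> simp only [descentProb] <;> split_ifs <;> simp [descentWeight_nonneg]

lemma descentProb_le_one (hn : 0 < n) (hmn : m ≤ n) (d : ℕ) (s : AccOp) :
    descentProb n m q d s ≤ 1 := by
  cases s <;> simp only [descentProb] <;> split_ifs <;>
    first | exact zero_le_one | exact descentWeight_le_one (by omega)

lemma descentWeight_succ (hm : 1 < m) (hd : d < m) :
    descentWeight n q (d + 1) =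
      ((d + 1 : ℕ) : ℝ) / n * opMean p q (descentProb n m q d) AccOp.AM := by
  match d with
  | 0 => simp [descentWeight, descentProb, opMean, hd]
  | 1 =>
    simp only [descentWeight, descentProb, opMean, hm, le_refl, if_true, Nat.reduceAdd,
      Nat.reduceSub, pow_zero, Nat.factorial]
    push_cast
    ring
  | d + 2 =>
    have hOI : ¬d + 2 ≤ 1 := by omega
    simp only [descentWeight, descentProb, opMean, hd, hOI, if_true, if_false,
      Nat.factorial_succ (d + 2), Nat.add_sub_cancel, show d + 2 + 1 - 2 = d + 1 by omega]
    push_cast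
    ring

lemma descentWeight_le_levelMean (hm : 1 < m) (hmn : m ≤ n) (h0 : 0 < d) (hd : d ≤ m) :
    descentWeight n q d ≤ levelMean n m p q (descentProb n m q) d AccOp.AM := by
  have hdn : (d : ℝ) / n ≤ 1 := div_le_one_of_le₀ (mod_cast hd.trans hmn) n.cast_nonneg
  obtain ⟨e, rfl⟩ := Nat.exists_eq_add_of_lt h0
  rw [zero_add] at hd hdn ⊢
  rw [descentWeight_succ (p := p) hm hd]
  exact le_add_of_nonneg_right
    (mul_nonneg (sub_nonneg.2 hdn) (opMean_nonneg (descentProb_nonneg _) _))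

lemma descentProb_le_levelMean (hm : 1 < m) (hmn : m ≤ n) (h0 : 0 < d) (hd : d ≤ n) (s : AccOp) :
    descentProb n m q d s ≤ levelMean n m p q (descentProb n m q) d s := by
  have hmean := levelMean_nonneg (n := n) (m := m) (p := p) (q := q) (Φ := descentProb n m q)
    descentProb_nonneg hd s
  cases s with
  | AM =>
    by_cases h : d < m
    · simpa only [descentProb, h, if_true] using
        descentWeight_le_levelMean (p := p) (q := q) hm hmn h0 h.le
    · simpa only [descentProb, h, if_false] using hmean
  | OI =>
    by_cases h : d ≤ 1
    · obtain rfl : d = 1 := by omega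
      have hdown : levelDown m AccOp.OI 1 = 0 := by simp [levelDown]
      have hone : opMean p q (descentProb n m q 0) AccOp.OI = 1 := by
        simp [opMean, descentProb, descentWeight, (by omega : 0 < m)]
      have hweight : descentProb n m q 1 AccOp.OI = (1 : ℕ) / n * 1 := by
        simp [descentProb, descentWeight]
      have hn : ((1 : ℕ) : ℝ) / n ≤ 1 := div_le_one_of_le₀ (mod_cast hd) n.cast_nonneg
      rw [levelMean, hdown, hone, hweight]
      exact le_add_of_nonneg_right
        (mul_nonneg (sub_nonneg.2 hn) (opMean_nonneg (descentProb_nonneg _) _))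
    · simpa only [descentProb, h, if_false] using hmean

end Descent

section Runtime

variable {n m : ℕ} {p q : unitInterval} {c d : ℝ}

theorem expectedRuntime_le [NeZero n] (hm : 1 < m) (hmn : 2 * m < n) (hp : (0 : ℝ) < p)
    (hq : (0 : ℝ) < q) (hq1 : (q : ℝ) < 1)
    (hpq : (p : ℝ) ≤ m / (2 * (n - 2 * m)) * (q + 4 / n)) :
    expectedRuntime n m p q ≤ ENNReal.ofReal
      (2 * ((1 + (p : ℝ) * n) * (1 / (p : ℝ) + 1 / (q : ℝ)) *
        ((n : ℝ) + (n : ℝ) ^ m / (((m - 1)! : ℕ) * (1 - (q : ℝ)) ^ (m - 2))))) := by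
  rw [← cycleLength]
  set S : ℝ := (1 + (p : ℝ) * n) * cycleLength p q with hS
  set W : ℝ := (n : ℝ) ^ m / (((m - 1)! : ℕ) * (1 - (q : ℝ)) ^ (m - 2))
  have hS0 : 0 ≤ S := mul_nonneg (by positivity) cycleLength_nonneg
  have : 0 ≤ 1 - (q : ℝ) := sub_nonneg.2 q.2.2
  have hW : W * descentWeight n q m = m := pow_div_mul_descentWeight (by omega) hq1
  have hK : 0 ≤ 2 * S * W := by positivity
  refine (expectedRuntime_le_add (R := returnPotential n m p q) (h := descentProb n m q)
    (returnPotential_nonneg (by omega))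
    (fun d s hd => returnPotential_le (by omega) (by omega) hp hd s) descentProb_nonneg
    (descentProb_le_one (by omega) (by omega)) hK fun d s h0 hd => ?_).trans
    (ENNReal.ofReal_le_ofReal ?_)
  · by_cases hds : d = m ∧ s = AccOp.AM
    · obtain ⟨rfl, rfl⟩ := hds
      have hreturn := levelMean_returnPotential_self_AM (q := q) hm hmn hp
      have hdescent := mul_le_mul_of_nonneg_left
        (descentWeight_le_levelMean (n := n) (p := p) (q := q) hm (by omega) h0 le_rfl) hK
      have hzero : descentProb n d q d AccOp.AM = 0 := by simp [descentProb]
      rw [mul_assoc _ W, hW] at hdescent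
      rw [returnPotential_AM_self, hzero]
      linarith
    · exact add_le_add (levelMean_returnPotential_le hm hmn hp hq hpq h0 hd hds)
        (mul_le_mul_of_nonneg_left (descentProb_le_levelMean hm (by omega) h0 hd s) hK)
  · rw [← hS]
    nlinarith [mul_nonneg hS0 n.cast_nonneg]

lemma le_div_sub_mul_add_of_le_div_mul {p q : ℝ} (hmn : 2 * m < n) (hq : 0 ≤ q)
    (h : p ≤ m / (2 * n) * q) : p ≤ m / (2 * (n - 2 * m)) * (q + 4 / n) := by
  have hgap : 0 < (n : ℝ) - 2 * m := sub_pos.2 (mod_cast hmn)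
  refine h.trans ?_
  gcongr
  · exact sub_le_self _ (by positivity)
  · exact le_add_of_nonneg_right (by positivity)

lemma one_add_mul_mul_le_of_eq (hc : 2 ≤ c) (hm : 0 < m) (hmn : m ≤ n) (hq : (0 : ℝ) < q)
    (hp : (p : ℝ) = m / (c * n) * q) :
    (1 + (p : ℝ) * n) * (1 / (p : ℝ) + 1 / (q : ℝ)) ≤ ((c + 1) / (m * q) + 2) * n := by
  have hm0 : (0 : ℝ) < m := mod_cast hm
  have hmn' : (m : ℝ) ≤ n := mod_cast hmn
  have hn0 : (0 : ℝ) < n := hm0.trans_le hmn'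
  have : 0 < c := by linarith
  have hinv : 1 / (n * q : ℝ) ≤ 1 / (m * q) := by gcongr
  have hratio : m / (c * n) ≤ (1 : ℝ) := div_le_one_of_le₀ (by nlinarith) (by positivity)
  calc (1 + (p : ℝ) * n) * (1 / (p : ℝ) + 1 / (q : ℝ))
      = (c / (m * q) + 1 / (n * q) + 1 + m / (c * n)) * n := by
        rw [hp]
        field_simp
        ring
    _ ≤ (c / (m * q) + 1 / (m * q) + 1 + 1) * n := by gcongr
    _ = ((c + 1) / (m * q) + 2) * n := by ring

theorem expectedRuntime_le_of_eq [NeZero n] (hc : 2 ≤ c) (hm : 1 < m) (hmn : 2 * m < n)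
    (hq : (0 : ℝ) < q) (hq1 : (q : ℝ) < 1) (hp : (p : ℝ) = m / (c * n) * q) :
    expectedRuntime n m p q ≤ ENNReal.ofReal
      (2 * ((c + 1) / (m * q) + 2) * ((n : ℝ) ^ 2 +
        (n : ℝ) ^ (m + 1) / (((m - 1)! : ℕ) * (1 - (q : ℝ)) ^ (m - 2)))) := by
  have hn0 : (0 : ℝ) < n := mod_cast (by omega : 0 < n)
  have hm0 : (0 : ℝ) < m := mod_cast (by omega : 0 < m)
  have hc0 : 0 < c := by linarith
  have hp0 : (0 : ℝ) < p := hp ▸ mul_pos (div_pos hm0 (mul_pos hc0 hn0)) hq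
  have hple : (p : ℝ) ≤ m / (2 * n) * q := by
    rw [hp]
    gcongr
  have hq1' : 0 ≤ 1 - (q : ℝ) := sub_nonneg.2 q.2.2
  refine (expectedRuntime_le hm hmn hp0 hq hq1
    (le_div_sub_mul_add_of_le_div_mul hmn hq.le hple)).trans (ENNReal.ofReal_le_ofReal ?_)
  grw [one_add_mul_mul_le_of_eq hc (by omega) (by omega) hq hp]
  refine le_of_eq ?_
  ring

theorem expectedRuntime_le_of_eq_half [NeZero n] (hc : 2 ≤ c) (hm : 1 < m) (hmn : 2 * m < n)
    (hq : (q : ℝ) = 1 / 2) (hp : (p : ℝ) = m / (c * n) * q) :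
    expectedRuntime n m p q ≤ ENNReal.ofReal
      (2 * (c + 3) * ((n : ℝ) ^ 2 + 2 ^ (m - 2) * (n : ℝ) ^ (m + 1) / ((m - 1)! : ℕ))) := by
  have hm' : (2 : ℝ) ≤ m := mod_cast hm
  have hcoeff : (c + 1) / (m * (1 / 2)) + 2 ≤ c + 3 := by
    have : (c + 1) / (m * (1 / 2)) ≤ c + 1 := div_le_self (by linarith) (by linarith)
    linarith
  have hpow : (n : ℝ) ^ (m + 1) / (((m - 1)! : ℕ) * (1 - 1 / 2) ^ (m - 2)) =
      2 ^ (m - 2) * (n : ℝ) ^ (m + 1) / ((m - 1)! : ℕ) := by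
    rw [show (1 - 1 / 2 : ℝ) = 2⁻¹ by norm_num, inv_pow]
    field_simp
  refine (expectedRuntime_le_of_eq hc hm hmn (by linarith) (by linarith) hp).trans
    (ENNReal.ofReal_le_ofReal ?_)
  rw [hq, hpow]
  gcongr

lemma inv_one_sub_pow_le_exp (hm : 1 < m) (hd : 1 ≤ d) :
    ((1 - 1 / (d * m)) ^ (m - 2))⁻¹ ≤ Real.exp (1 / d) := by
  have hm' : (2 : ℝ) ≤ m := mod_cast hm
  have hdm : 0 < d * m - 1 := by nlinarith
  have hinv : (1 - 1 / (d * m))⁻¹ = 1 / (d * m - 1) + 1 := by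
    rw [one_sub_div (by linarith)]
    field_simp
    ring
  calc ((1 - 1 / (d * m)) ^ (m - 2))⁻¹ = (1 / (d * m - 1) + 1) ^ (m - 2) := by
        rw [← inv_pow, hinv]
    _ ≤ Real.exp (1 / (d * m - 1)) ^ (m - 2) := by
        gcongr
        exact Real.add_one_le_exp _
    _ = Real.exp ((m - 2 : ℕ) * (1 / (d * m - 1))) := (Real.exp_nat_mul _ _).symm
    _ ≤ Real.exp (1 / d) := by
        rw [Real.exp_le_exp, Nat.cast_sub hm, mul_one_div, div_le_div_iff₀ hdm (by linarith)]
        push_cast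
        linarith

theorem expectedRuntime_le_of_eq_one_div [NeZero n] (hc : 2 ≤ c) (hd : 1 ≤ d) (hm : 1 < m)
    (hmn : 2 * m < n) (hq : (q : ℝ) = 1 / (d * m)) (hp : (p : ℝ) = m / (c * n) * q) :
    expectedRuntime n m p q ≤ ENNReal.ofReal
      (2 * ((c + 1) * d + 2) *
        ((n : ℝ) ^ 2 + Real.exp (1 / d) * (n : ℝ) ^ (m + 1) / ((m - 1)! : ℕ))) := by
  have hm' : (2 : ℝ) ≤ m := mod_cast hm
  have hdm : 1 < d * m := by nlinarith
  have hq0 : (0 : ℝ) < q := by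
    rw [hq]
    positivity
  have hq1 : (q : ℝ) < 1 := by
    rw [hq]
    exact (div_lt_one (by linarith)).2 hdm
  have hcoeff : (c + 1) / (m * (1 / (d * m))) = (c + 1) * d := by
    field_simp
  have hpow : (n : ℝ) ^ (m + 1) / (((m - 1)! : ℕ) * (1 - 1 / (d * m)) ^ (m - 2)) ≤
      Real.exp (1 / d) * (n : ℝ) ^ (m + 1) / ((m - 1)! : ℕ) :=
    calc (n : ℝ) ^ (m + 1) / (((m - 1)! : ℕ) * (1 - 1 / (d * m)) ^ (m - 2))
        = ((1 - 1 / (d * m)) ^ (m - 2))⁻¹ * (n : ℝ) ^ (m + 1) / ((m - 1)! : ℕ) := by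
          field_simp
      _ ≤ Real.exp (1 / d) * (n : ℝ) ^ (m + 1) / ((m - 1)! : ℕ) := by
          gcongr
          exact inv_one_sub_pow_le_exp hm hd
  refine (expectedRuntime_le_of_eq hc hm hmn hq0 hq1 hp).trans (ENNReal.ofReal_le_ofReal ?_)
  rw [hq, hcoeff]
  gcongr

lemma two_pow_pred_le_factorial : ∀ k : ℕ, 2 ^ (k - 1) ≤ k !
  | 0 => le_rfl
  | k + 1 => by simpa [add_comm] using Nat.factorial_mul_pow_le_factorial (m := 1) (n := k)

lemma sq_add_two_pow_mul_le (hm : 1 < m) (hn : 0 < n) :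
    (n : ℝ) ^ 2 + 2 ^ (m - 2) * (n : ℝ) ^ (m + 1) / ((m - 1)! : ℕ) ≤ 2 * (n : ℝ) ^ (m + 1) := by
  have hsq : (n : ℝ) ^ 2 ≤ (n : ℝ) ^ (m + 1) := pow_le_pow_right₀ (mod_cast hn) (by omega)
  have hfac : (2 : ℝ) ^ (m - 2) / ((m - 1)! : ℕ) ≤ 1 :=
    div_le_one_of_le₀ (mod_cast two_pow_pred_le_factorial (m - 1)) (by positivity)
  rw [mul_div_right_comm, two_mul]
  exact add_le_add hsq (mul_le_of_le_one_left (by positivity) hfac)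

lemma sq_le_pow_div_factorial (hm : 0 < m) (hmn : m ≤ n) :
    (n : ℝ) ^ 2 ≤ (n : ℝ) ^ (m + 1) / ((m - 1)! : ℕ) := by
  have hfac : (m - 1)! ≤ n ^ (m - 1) :=
    (Nat.factorial_le_pow _).trans (Nat.pow_le_pow_left (by omega) _)
  rw [le_div_iff₀ (by positivity)]
  calc (n : ℝ) ^ 2 * ((m - 1)! : ℕ) ≤ (n : ℝ) ^ 2 * (n : ℝ) ^ (m - 1) := by
        gcongr
        exact_mod_cast hfac
    _ = (n : ℝ) ^ (m + 1) := by
        rw [← pow_add]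
        congr 1
        omega

lemma le_ofReal_mul_and_le {E : ℝ≥0∞} {A B C₁ C₂ : ℝ} (hA : 0 ≤ A) (hC₁ : 1 ≤ C₁) (hC₂ : 1 ≤ C₂)
    (hE : E ≤ ENNReal.ofReal (C₁ * A)) (hAB : A ≤ C₂ * B) :
    E ≤ ENNReal.ofReal (C₁ * C₂ * A) ∧ A ≤ C₁ * C₂ * B ∧ E ≤ ENNReal.ofReal (C₁ * C₂ * B) := by
  refine ⟨hE.trans (ENNReal.ofReal_le_ofReal ?_), ?_, hE.trans (ENNReal.ofReal_le_ofReal ?_)⟩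
  · exact mul_le_mul_of_nonneg_right (le_mul_of_one_le_right (by linarith) hC₂) hA
  · rw [mul_assoc]
    exact hAB.trans (le_mul_of_one_le_left (hA.trans hAB) hC₁)
  · rw [mul_assoc]
    gcongr

end Runtime

end MMAHH

theorem mainTheorem2 :
    (∃ C : ℝ, 0 < C ∧ ∀ (n m : ℕ) [NeZero n] (p q : unitInterval),
      1 < m → 2 * m < n → 0 < p → p < 1 → 0 < q → q < 1 →
      (m : ℝ) / (2 * ((n : ℝ) - 2 * m)) * ((q : ℝ) + 4 / n) ≥ p →
      MMAHH.expectedRuntime n m p q ≤ ENNReal.ofReal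
        (C * ((1 + (p : ℝ) * n) * (1 / (p : ℝ) + 1 / (q : ℝ)) *
          ((n : ℝ) + (n : ℝ) ^ m / (((m - 1)! : ℕ) * (1 - (q : ℝ)) ^ (m - 2)))))) ∧
    (∀ (n m : ℕ) (p q : unitInterval),
      1 < m → 2 * m < n → 0 < p → p < 1 → 0 < q → q < 1 →
      (m : ℝ) / (2 * n) * (q : ℝ) ≥ p →
      (m : ℝ) / (2 * ((n : ℝ) - 2 * m)) * ((q : ℝ) + 4 / n) ≥ p) ∧
    (∀ c : ℝ, 2 ≤ c → ∃ C : ℝ, 0 < C ∧ ∀ (n m : ℕ) [NeZero n] (p q : unitInterval),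
      1 < m → 2 * m < n → (q : ℝ) = 1 / 2 → (p : ℝ) = (m : ℝ) / (c * n) * q →
      MMAHH.expectedRuntime n m p q ≤ ENNReal.ofReal
        (C * ((n : ℝ) ^ 2 + 2 ^ (m - 2) * (n : ℝ) ^ (m + 1) / ((m - 1)! : ℕ))) ∧
      (n : ℝ) ^ 2 + 2 ^ (m - 2) * (n : ℝ) ^ (m + 1) / ((m - 1)! : ℕ) ≤ C * (n : ℝ) ^ (m + 1) ∧
      MMAHH.expectedRuntime n m p q ≤ ENNReal.ofReal (C * (n : ℝ) ^ (m + 1))) ∧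
    (∀ c d : ℝ, 2 ≤ c → 1 ≤ d → ∃ C : ℝ, 0 < C ∧ ∀ (n m : ℕ) [NeZero n] (p q : unitInterval),
      1 < m → 2 * m < n → (q : ℝ) = 1 / (d * m) → (p : ℝ) = (m : ℝ) / (c * n) * q →
      MMAHH.expectedRuntime n m p q ≤ ENNReal.ofReal
        (C * ((n : ℝ) ^ 2 + Real.exp (1 / d) * (n : ℝ) ^ (m + 1) / ((m - 1)! : ℕ))) ∧
      (n : ℝ) ^ 2 + Real.exp (1 / d) * (n : ℝ) ^ (m + 1) / ((m - 1)! : ℕ) ≤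
        C * ((n : ℝ) ^ (m + 1) / ((m - 1)! : ℕ)) ∧
      MMAHH.expectedRuntime n m p q ≤
        ENNReal.ofReal (C * ((n : ℝ) ^ (m + 1) / ((m - 1)! : ℕ)))) := by
  refine ⟨⟨2, two_pos, fun n m _ p q hm hmn hp _ hq hq1 hpq =>
      MMAHH.expectedRuntime_le hm hmn hp hq hq1 hpq⟩,
    fun n m p q _ hmn _ _ hq _ hpq => MMAHH.le_div_sub_mul_add_of_le_div_mul hmn hq.le hpq,
    fun c hc => ⟨2 * (c + 3) * 2, by positivity, fun n m _ p q hm hmn hq hp =>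
      MMAHH.le_ofReal_mul_and_le (by positivity) (by linarith) one_le_two
        (MMAHH.expectedRuntime_le_of_eq_half hc hm hmn hq hp)
        (MMAHH.sq_add_two_pow_mul_le hm (by omega))⟩,
    fun c d hc hd => ⟨2 * ((c + 1) * d + 2) * (1 + Real.exp (1 / d)), by positivity,
      fun n m _ p q hm hmn hq hp =>
        MMAHH.le_ofReal_mul_and_le (by positivity) (by nlinarith)
          (le_add_of_nonneg_right (Real.exp_pos _).le)
          (MMAHH.expectedRuntime_le_of_eq_one_div hc hd hm hmn hq hp) ?_⟩⟩
  rw [add_mul, one_mul, ← mul_div_assoc]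
  gcongr
  exact MMAHH.sq_le_pow_div_factorial (by omega) (by omega)
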